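/- Let $G$ be a finite simple graph with $n \ge 6$ vertices, and let $\mu(G)$ denote its spectral radius, i.e. the largest eigenvalue of its adjacency matrix. Let $P_n$, $K_n$ and $S_n$ denote the path, the complete graph and the star on $n$ vertices. Let $P_n^2$ be the graph on the vertex set of $P_n$ in which two distinct vertices are adjacent if and only if their distance in $P_n$ is at most two. For $m \le n$ and a graph $H$ on $m$ vertices, let $K_n - E(H)$ be the graph obtained from $K_n$ by deleting the edges of a copy of $H$. Containment of graphs is understood up to isomorphism: a graph contains $F$ (and $F$ is a subgraph of it) if it has a not necessarily induced subgraph isomorphic to $F$. If $\mu(G) > n-2$, then at least one of the following holds: 1. $G$ contains $P_n^2$; 2. $G$ is a subgraph of $K_n - E(S_{n-1})$; 3. $n = 6$ and $G$ is a subgraph of $K_6 - E(K_3)$. -/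

import Mathlib

open scoped SimpleGraph

namespace SimpleGraph

/-- The spectral radius `μ(G)` of a finite graph: the largest eigenvalue of its adjacency
matrix over the reals (see `isGreatest_adjSpectralRadius`). -/
noncomputable def adjSpectralRadius {V : Type*} [Fintype V] [DecidableEq V]
    (G : SimpleGraph V) [DecidableRel G.Adj] : ℝ :=
  sSup {x : ℝ | Module.End.HasEigenvalue (Matrix.toLin' (G.adjMatrix ℝ)) x}

/-- On a nonempty vertex set, the supremum in the definition of `μ(G)` is a maximum. -/
theorem isGreatest_adjSpectralRadius {V : Type*} [Fintype V] [DecidableEq V] [Nonempty V]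
    (G : SimpleGraph V) [DecidableRel G.Adj] :
    IsGreatest {x : ℝ | Module.End.HasEigenvalue (Matrix.toLin' (G.adjMatrix ℝ)) x}
      G.adjSpectralRadius := by
  have hset : {x : ℝ | Module.End.HasEigenvalue (Matrix.toLin' (G.adjMatrix ℝ)) x}
      = spectrum ℝ (G.adjMatrix ℝ) := by
    ext x
    rw [Set.mem_ofPred_eq, Module.End.hasEigenvalue_iff_mem_spectrum, Matrix.spectrum_toLin']
  have hH : (G.adjMatrix ℝ).IsHermitian := G.isHermitian_adjMatrix ℝ
  have hfin : (spectrum ℝ (G.adjMatrix ℝ)).Finite := by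
    rw [hH.spectrum_real_eq_range_eigenvalues]
    exact Set.finite_range _
  have hne : (spectrum ℝ (G.adjMatrix ℝ)).Nonempty := by
    rw [hH.spectrum_real_eq_range_eigenvalues]
    exact Set.range_nonempty _
  unfold adjSpectralRadius
  rw [hset]
  exact ⟨hne.csSup_mem hfin, fun x hx => le_csSup hfin.bddAbove hx⟩

/-- The 2-power `G²` of a graph: same vertices, and two distinct vertices are adjacent when
their (extended) distance in `G` is at most two. -/
def square {V : Type*} (G : SimpleGraph V) : SimpleGraph V where
  Adj u v := u ≠ v ∧ G.edist u v ≤ 2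
  symm := ⟨fun u v h => ⟨h.1.symm, by rw [edist_comm]; exact h.2⟩⟩
  loopless := ⟨fun _ h => h.1 rfl⟩

/-- `K_n - E(H)` for a graph `H` on `m ≤ n` vertices: the complete graph on `n` vertices
from which the edges of a copy of `H` are deleted (by the symmetry of `K_n` the position of
the copy does not matter up to isomorphism; here it sits on the first `m` vertices). -/
def completeMinus (n : ℕ) {m : ℕ} (h : m ≤ n) (H : SimpleGraph (Fin m)) :
    SimpleGraph (Fin n) :=
  (⊤ : SimpleGraph (Fin n)).deleteEdges (H.map (Fin.castLEEmb h)).edgeSet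

end SimpleGraph

/-!
Let `H` be the complement of `G`, with `e` edges, and let `c` be a vertex of maximum degree `Δ`
of `H`. Let `f = e - Δ` be the number of edges of `H` that avoid `c`.

Spectral part (`adjSpectralRadius_le_card_sub_two`): if `2 e ≥ n - 1 + Δ`, then the positive vector
`x v = n - 1 + Δ - deg_H v` satisfies `A x ≤ (n - 2) x`, so `μ(G) ≤ n - 2`. Hence `μ(G) > n - 2`
forces `2 e ≤ n - 2 + Δ`, which is `e + f ≤ n - 2`.

Combinatorial part: `G` contains the square of a path on all its vertices exactly when the vertices
can be listed such that `H`-adjacent vertices are at distance at least three in the list. If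
`f ≥ 2`, then `e ≤ n - 4`, and every graph with so few edges has such a list
(`arrangeable_of_degreeSumIn_add_eight_le`). If `f = 1`, then `c` has at least three
non-neighbours in `H`, and there is an explicit list unless `n = 6` and `H` contains a triangle.
If `f = 0`, then `H` is a star with at most `n - 2` edges; there is a list unless it has exactly
`n - 2` edges, and then `G` is contained in `K_n - E(S_{n-1})`.
-/

namespace SimpleGraph

variable {V : Type*}

/-! ### A spectral bound for nearly complete graphs -/

/-- Collatz–Wielandt bound: if `A` is entrywise nonnegative and `A x ≤ r x` for some positive
vector `x`, then no real eigenvalue of `A` exceeds `r`. -/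
theorem eigenvalue_le_of_positive_vector [Fintype V] (A : Matrix V V ℝ) (hA : ∀ u v, 0 ≤ A u v)
    (x : V → ℝ) (hx : ∀ v, 0 < x v) (r : ℝ) (hr : ∀ u, (A.mulVec x) u ≤ r * x u) (θ : ℝ)
    (hθ : Module.End.HasEigenvalue (Matrix.mulVecLin A) θ) : θ ≤ r := by
  obtain ⟨y, hy⟩ := hθ.exists_hasEigenvector
  have hy0 : y ≠ 0 := hy.2
  have hAy : A.mulVec y = θ • y := hy.apply_eq_smul
  obtain ⟨w, hw⟩ : ∃ w, y w ≠ 0 := by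
    by_contra! h
    exact hy0 (funext h)
  obtain ⟨u, -, hu⟩ := Finset.exists_max_image Finset.univ (fun v => |y v| / x v)
    ⟨w, Finset.mem_univ w⟩
  have ht : 0 < |y u| / x u :=
    (div_pos (abs_pos.2 hw) (hx w)).trans_le (hu w (Finset.mem_univ w))
  have hle : ∀ v, |y v| ≤ |y u| / x u * x v := fun v =>
    (div_le_iff₀ (hx v)).1 (hu v (Finset.mem_univ v))
  have hyu : |y u| = |y u| / x u * x u := (div_mul_cancel₀ _ (hx u).ne').symm
  have hyu0 : 0 < |y u| := by
    rw [hyu]; exact mul_pos ht (hx u)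
  have h1 : θ * |y u| ≤ r * |y u| := by
    calc θ * |y u| ≤ |θ * y u| := by
          rw [abs_mul]; exact mul_le_mul_of_nonneg_right (le_abs_self θ) (abs_nonneg _)
      _ = |∑ v, A u v * y v| := by
          congr 1; exact (congrFun hAy u).symm
      _ ≤ ∑ v, A u v * (|y u| / x u * x v) := by
          refine (Finset.abs_sum_le_sum_abs _ _).trans (Finset.sum_le_sum fun v _ => ?_)
          rw [abs_mul, abs_of_nonneg (hA u v)]
          exact mul_le_mul_of_nonneg_left (hle v) (hA u v)
      _ = |y u| / x u * (A.mulVec x) u := by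
          simp only [Matrix.mulVec, dotProduct, Finset.mul_sum]
          exact Finset.sum_congr rfl fun v _ => by ring
      _ ≤ |y u| / x u * (r * x u) := mul_le_mul_of_nonneg_left (hr u) ht.le
      _ = r * |y u| := by
          conv_rhs => rw [hyu]
          ring
  exact le_of_mul_le_mul_right h1 hyu0

/-- Let the complement of `G` have `e` edges and maximum degree at most `D`, and let `n` be the
number of vertices. If `2 e ≥ n - 1 + D`, then `μ(G) ≤ n - 2`. The test vector is
`x v = n - 1 + D - h v`, where `h v` is the degree of `v` in the complement: it is the first-order
approximation to the Perron vector of a nearly complete graph, with a denominator chosen so that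
the second-order terms have the right sign. -/
theorem adjSpectralRadius_le_card_sub_two [Fintype V] [DecidableEq V] [Nonempty V]
    (G : SimpleGraph V) [DecidableRel G.Adj] (D : ℕ) (hD : ∀ v, Gᶜ.degree v ≤ D)
    (hcard : 2 ≤ Fintype.card V)
    (hsum : Fintype.card V + D ≤ ∑ v, Gᶜ.degree v + 1) :
    G.adjSpectralRadius ≤ Fintype.card V - 2 := by
  have hn : (2 : ℝ) ≤ Fintype.card V := by exact_mod_cast hcard
  have hDR : ∀ v, (Gᶜ.degree v : ℝ) ≤ D := fun v => by exact_mod_cast hD v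
  have hsumR : (Fintype.card V : ℝ) + D ≤ ∑ v, (Gᶜ.degree v : ℝ) + 1 := by exact_mod_cast hsum
  refine eigenvalue_le_of_positive_vector (G.adjMatrix ℝ) ?_
    (fun v => (Fintype.card V - 1 + D : ℝ) - Gᶜ.degree v) ?_ _ ?_ _
    (isGreatest_adjSpectralRadius G).1
  · intro u v
    rw [adjMatrix_apply]
    split_ifs <;> norm_num
  · intro v
    linarith [hDR v]
  · intro u
    rw [adjMatrix_mulVec_apply]
    -- Writing `S = ∑ v, x v`, the claim at `u` is `S ≤ (n - 1) x u + ∑ x v`, the sum being over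
    -- the neighbours `v` of `u` in the complement. The right side is at least
    -- `(n - 1) (n - 1 + D)`, as each of these `x v` is at least `n - 1`.
    set x : V → ℝ := fun v => (Fintype.card V - 1 + D : ℝ) - Gᶜ.degree v with hx
    have hsplit : ∑ v ∈ G.neighborFinset u, x v + ∑ v ∈ Gᶜ.neighborFinset u, x v + x u
        = ∑ v, x v := by
      have hdisj : Disjoint (G.neighborFinset u) (Gᶜ.neighborFinset u) := by
        rw [Finset.disjoint_left]
        intro v h1 h2
        simp only [mem_neighborFinset, compl_adj] at h1 h2
        exact h2.2 h1
      rw [← Finset.sum_union hdisj, add_comm, ← Finset.sum_insert]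
      · congr 1
        ext v
        simp only [Finset.mem_insert, Finset.mem_union, mem_neighborFinset, compl_adj,
          Finset.mem_univ, iff_true]
        by_cases h : v = u
        · exact Or.inl h
        · have : u ≠ v := fun h' => h h'.symm
          tauto
      · simp
    have htot : ∑ v, x v = Fintype.card V * (Fintype.card V - 1 + D) - ∑ v, (Gᶜ.degree v : ℝ) := by
      simp only [hx, Finset.sum_sub_distrib, Finset.sum_const, Finset.card_univ, nsmul_eq_mul]
    have hnb : (Gᶜ.degree u : ℝ) * (Fintype.card V - 1) ≤ ∑ v ∈ Gᶜ.neighborFinset u, x v := by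
      rw [← card_neighborFinset_eq_degree, ← nsmul_eq_mul]
      refine Finset.card_nsmul_le_sum _ _ _ fun v _ => ?_
      simp only [hx]
      linarith [hDR v]
    have hxu : x u = (Fintype.card V - 1 + D : ℝ) - Gᶜ.degree u := rfl
    change _ ≤ ((Fintype.card V : ℝ) - 2) * x u
    have hb : ((Fintype.card V : ℝ) - 1) * x u
        = ((Fintype.card V : ℝ) - 1) * (Fintype.card V - 1 + D)
          - (Gᶜ.degree u : ℝ) * (Fintype.card V - 1) := by
      rw [hxu]; ring
    linarith

/-! ### Spread lists of vertices -/

/-- A list of vertices is `Spread` when no two entries at distance one or two in the list are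
`H`-adjacent. A spread list of all vertices, without repetition,
is a copy of the square of a path in the complement
of `H`. -/
def Spread (H : SimpleGraph V) : List V → Prop
  | [] => True
  | a :: l => (∀ b ∈ l.take 2, ¬ H.Adj a b) ∧ Spread H l

theorem spread_iff_getElem {H : SimpleGraph V} {l : List V} :
    Spread H l ↔ ∀ (i j : ℕ) (hij : i < j) (hj : j < l.length), j ≤ i + 2 →
      ¬ H.Adj (l[i]'(hij.trans hj)) l[j] := by
  induction l with
  | nil => simp [Spread]
  | cons a l ih =>
    rw [Spread, ih]
    constructor
    · rintro ⟨h1, h2⟩ (_ | i) (_ | j) hij hj hji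
      · omega
      · refine h1 _ (List.mem_take_iff_getElem.2 ⟨j, ?_, rfl⟩)
        simp only [List.length_cons] at hj
        omega
      · omega
      · exact h2 i j (by omega) (by simpa using hj) (by omega)
    · intro h
      refine ⟨fun b hb => ?_, fun i j hij hj hji =>
        h (i + 1) (j + 1) (by omega) (by simpa using hj) (by omega)⟩
      obtain ⟨j, hj, rfl⟩ := List.mem_take_iff_getElem.1 hb
      exact h 0 (j + 1) (by omega) (by simp; omega) (by omega)

theorem Spread.reverse {H : SimpleGraph V} {l : List V} (h : Spread H l) :
    Spread H l.reverse := by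
  rw [spread_iff_getElem] at h ⊢
  intro i j hij hj hji hadj
  rw [List.length_reverse] at hj
  rw [List.getElem_reverse, List.getElem_reverse] at hadj
  exact h (l.length - 1 - j) (l.length - 1 - i) (by omega) (by omega) (by omega) hadj.symm

theorem Spread.cons_of_forall {H : SimpleGraph V} {l : List V} {a : V}
    (ha : ∀ b ∈ l, ¬ H.Adj a b) (h : Spread H l) : Spread H (a :: l) :=
  ⟨fun b hb => ha b (List.mem_of_mem_take hb), h⟩

theorem Spread.cons_cons_cons {H : SimpleGraph V} {l : List V} {a b c : V}
    (hab : ¬ H.Adj a b) (hac : ¬ H.Adj a c) (h : Spread H (b :: c :: l)) :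
    Spread H (a :: b :: c :: l) :=
  ⟨by simp [hab, hac], h⟩

theorem spread_of_forall {H : SimpleGraph V} {l : List V}
    (h : ∀ a ∈ l, ∀ b ∈ l, ¬ H.Adj a b) : Spread H l :=
  spread_iff_getElem.2 fun _ _ _ _ _ => h _ (List.getElem_mem _) _ (List.getElem_mem _)

/-- The vertices of `S` can be listed, each exactly once, in a spread way. -/
def Arrangeable (H : SimpleGraph V) (S : Finset V) : Prop :=
  ∃ l : List V, l.Nodup ∧ (∀ v, v ∈ l ↔ v ∈ S) ∧ Spread H l

/-! ### Degrees within a set of vertices -/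

open Classical in
/-- The number of `H`-neighbours of `v` in `S`; the vertex `v` need not belong to `S`. -/
noncomputable def degreeIn (H : SimpleGraph V) (S : Finset V) (v : V) : ℕ :=
  (S.filter (H.Adj v)).card

/-- The degree sum of the subgraph of `H` induced on `S`, that is, twice its number of edges. -/
noncomputable def degreeSumIn (H : SimpleGraph V) (S : Finset V) : ℕ :=
  ∑ v ∈ S, H.degreeIn S v

theorem degreeIn_erase_self [DecidableEq V] (H : SimpleGraph V) (S : Finset V) (v : V) :
    H.degreeIn (S.erase v) v = H.degreeIn S v := by
  classical
  unfold degreeIn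
  congr 1
  ext u
  simp only [Finset.mem_filter, Finset.mem_erase]
  exact ⟨fun h => ⟨h.1.2, h.2⟩, fun h => ⟨⟨h.2.ne', h.1⟩, h.2⟩⟩

theorem degreeSumIn_erase [DecidableEq V] (H : SimpleGraph V) {S : Finset V} {v : V}
    (hv : v ∈ S) :
    H.degreeSumIn (S.erase v) + 2 * H.degreeIn S v = H.degreeSumIn S := by
  classical
  have h1 : ∀ u ∈ S.erase v,
      H.degreeIn S u = H.degreeIn (S.erase v) u + if H.Adj v u then 1 else 0 := by
    intro u _
    unfold degreeIn
    rw [Finset.filter_erase]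
    split_ifs with h
    · exact (Finset.card_erase_add_one (Finset.mem_filter.2 ⟨hv, h.symm⟩)).symm
    · rw [Finset.erase_eq_of_notMem (fun hm => h (Finset.mem_filter.1 hm).2.symm), add_zero]
  have h2 : ∑ u ∈ S.erase v, (if H.Adj v u then 1 else 0) = H.degreeIn S v := by
    rw [← degreeIn_erase_self, degreeIn, Finset.card_filter]
  unfold degreeSumIn
  rw [← Finset.add_sum_erase S _ hv, Finset.sum_congr rfl h1, Finset.sum_add_distrib, h2]
  ring

theorem degreeIn_eq_zero {H : SimpleGraph V} {S : Finset V} {v : V} :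
    H.degreeIn S v = 0 ↔ ∀ u ∈ S, ¬ H.Adj v u := by
  classical
  rw [degreeIn, Finset.card_eq_zero, Finset.filter_eq_empty_iff]

theorem degreeIn_pos {H : SimpleGraph V} {S : Finset V} {u v : V} (hu : u ∈ S)
    (h : H.Adj v u) : 0 < H.degreeIn S v :=
  Nat.pos_of_ne_zero fun h0 => degreeIn_eq_zero.1 h0 u hu h

theorem degreeIn_mono (H : SimpleGraph V) {S T : Finset V} (h : S ⊆ T) (v : V) :
    H.degreeIn S v ≤ H.degreeIn T v := by
  classical
  exact Finset.card_le_card (Finset.filter_subset_filter _ h)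

theorem not_adj_of_degreeSumIn_lt_two {H : SimpleGraph V} {S : Finset V}
    (h : H.degreeSumIn S < 2) {u v : V} (hu : u ∈ S) (hv : v ∈ S) : ¬ H.Adj u v := by
  classical
  intro hadj
  have h1 := degreeSumIn_erase H hu
  have h2 := degreeIn_pos hv hadj
  omega

/-! ### Spread lists of sparse graphs -/

theorem arrangeable_of_forall {H : SimpleGraph V} {S : Finset V}
    (h : ∀ u ∈ S, ∀ v ∈ S, ¬ H.Adj u v) : Arrangeable H S :=
  ⟨S.toList, S.nodup_toList, fun _ => Finset.mem_toList,
    spread_of_forall fun a ha b hb => h a (Finset.mem_toList.1 ha) b (Finset.mem_toList.1 hb)⟩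

/-- A vertex with at most one neighbour `p` in `S` can be put at one end of a list of `S`: with at
least four entries, `p` cannot be among the first two and among the last two. -/
theorem Arrangeable.insert_leaf [DecidableEq V] {H : SimpleGraph V} {S : Finset V} {v p : V}
    (h : Arrangeable H S) (hcard : 4 ≤ S.card) (hv : v ∉ S)
    (hp : ∀ u ∈ S, H.Adj v u → u = p) : Arrangeable H (insert v S) := by
  obtain ⟨l, hl, hmem, hs⟩ := h
  have hlen : 4 ≤ l.length := by
    rwa [← List.toFinset_card_of_nodup hl,
      show l.toFinset = S from Finset.ext fun u => by rw [List.mem_toFinset, hmem]]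
  by_cases hpl : p ∈ l.take 2
  · refine ⟨v :: l.reverse, ?_, fun u => by simp [hmem], ?_, hs.reverse⟩
    · simpa [hmem, hv] using hl
    · intro b hb hadj
      have hbl : b ∈ l := by simpa using List.mem_of_mem_take hb
      obtain rfl := hp b ((hmem b).1 hbl) hadj
      rw [List.mem_take_iff_getElem] at hpl hb
      obtain ⟨i, hi, hib⟩ := hpl
      obtain ⟨j, hj, hjb⟩ := hb
      rw [List.getElem_reverse, ← hib, hl.getElem_inj_iff] at hjb
      simp only [List.length_reverse] at hj
      omega
  · refine ⟨v :: l, ?_, fun u => by simp [hmem], ?_, hs⟩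
    · simpa [hmem, hv] using hl
    · intro b hb hadj
      obtain rfl := hp b ((hmem b).1 (List.mem_of_mem_take hb)) hadj
      exact hpl hb

/-- A vertex `w` can be put in front of any spread list, separated from it by the
two isolated vertices `i`, `j`. -/
theorem Arrangeable.of_erase_padded [DecidableEq V] {H : SimpleGraph V} {S : Finset V} {w i j : V}
    (hw : w ∈ S) (hi : i ∈ S) (hj : j ∈ S) (hwi : w ≠ i) (hwj : w ≠ j) (hij : i ≠ j)
    (hi0 : H.degreeIn S i = 0) (hj0 : H.degreeIn S j = 0)
    (h : Arrangeable H (((S.erase w).erase i).erase j)) : Arrangeable H S := by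
  rw [degreeIn_eq_zero] at hi0 hj0
  obtain ⟨l, hl, hmem, hs⟩ := h
  have hlS : ∀ b ∈ l, b ∈ S := fun b hb => by
    have := (hmem b).1 hb
    simp only [Finset.mem_erase] at this
    tauto
  refine ⟨w :: i :: j :: l, ?_, fun u => ?_, ?_⟩
  · simp [hmem, hl, hwi, hwj, hij]
  · simp only [List.mem_cons, hmem, Finset.mem_erase]
    by_cases h1 : u = w
    · simp [h1, hw]
    by_cases h2 : u = i
    · simp [h2, hi]
    by_cases h3 : u = j
    · simp [h3, hj]
    simp [h1, h2, h3]
  · refine Spread.cons_cons_cons (fun h => hi0 w hw h.symm) (fun h => hj0 w hw h.symm) ?_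
    refine Spread.cons_of_forall ?_ (Spread.cons_of_forall (fun b hb => hj0 b (hlS b hb)) hs)
    intro b hb
    refine hi0 b ?_
    rcases List.mem_cons.1 hb with rfl | hb
    exacts [hj, hlS b hb]

/-- Two nonadjacent vertices `u`, `w` can be put in front of any spread list, separated from it by
the two isolated vertices `i`, `j`. -/
theorem Arrangeable.of_erase_pair_padded [DecidableEq V] {H : SimpleGraph V} {S : Finset V}
    {u w i j : V} (hu : u ∈ S) (hw : w ∈ S) (hi : i ∈ S) (hj : j ∈ S) (huw : u ≠ w) (hui : u ≠ i)
    (huj : u ≠ j) (hwi : w ≠ i) (hwj : w ≠ j) (hij : i ≠ j) (hadj : ¬ H.Adj u w)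
    (hi0 : H.degreeIn S i = 0) (hj0 : H.degreeIn S j = 0)
    (h : Arrangeable H ((((S.erase u).erase w).erase i).erase j)) : Arrangeable H S := by
  rw [degreeIn_eq_zero] at hi0 hj0
  obtain ⟨l, hl, hmem, hs⟩ := h
  have hlS : ∀ b ∈ l, b ∈ S := fun b hb => by
    have := (hmem b).1 hb
    simp only [Finset.mem_erase] at this
    tauto
  refine ⟨u :: w :: i :: j :: l, ?_, fun v => ?_, ?_⟩
  · simp [hmem, hl, hwi, hwj, hij, huw, hui, huj]
  · simp only [List.mem_cons, hmem, Finset.mem_erase]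
    by_cases h0 : v = u
    · simp [h0, hu]
    by_cases h1 : v = w
    · simp [h1, hw]
    by_cases h2 : v = i
    · simp [h2, hi]
    by_cases h3 : v = j
    · simp [h3, hj]
    simp [h0, h1, h2, h3]
  · refine Spread.cons_cons_cons hadj (fun h => hi0 u hu h.symm) ?_
    refine Spread.cons_cons_cons (fun h => hi0 w hw h.symm) (fun h => hj0 w hw h.symm) ?_
    refine Spread.cons_of_forall ?_ (Spread.cons_of_forall (fun b hb => hj0 b (hlS b hb)) hs)
    intro b hb
    refine hi0 b ?_
    rcases List.mem_cons.1 hb with rfl | hb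
    exacts [hj, hlS b hb]

open Classical in
/-- If at most three vertices of `S` are not isolated and `S` has four isolated vertices, the
nonisolated vertices can be separated by pairs of isolated ones. -/
theorem arrangeable_of_card_support_le_three {H : SimpleGraph V} {S : Finset V}
    {i j k m : V} (hi : i ∈ S) (hj : j ∈ S) (hk : k ∈ S) (hm : m ∈ S)
    (hij : i ≠ j) (hik : i ≠ k) (him : i ≠ m) (hjk : j ≠ k) (hjm : j ≠ m) (hkm : k ≠ m)
    (hi0 : H.degreeIn S i = 0) (hj0 : H.degreeIn S j = 0) (hk0 : H.degreeIn S k = 0)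
    (hm0 : H.degreeIn S m = 0) (hC : (S.filter (fun v => H.degreeIn S v ≠ 0)).card ≤ 3) :
    Arrangeable H S := by
  set C := S.filter (fun v => H.degreeIn S v ≠ 0) with hCdef
  have hne : ∀ {a b : V}, H.degreeIn S a ≠ 0 → H.degreeIn S b = 0 → a ≠ b := by
    rintro a b ha hb rfl
    exact ha hb
  have hmemC : ∀ {a b : V}, a ∈ S → b ∈ S → H.Adj a b → a ∈ C := fun ha hb h =>
    Finset.mem_filter.2 ⟨ha, (degreeIn_pos hb h).ne'⟩
  by_cases hE : ∀ u ∈ S, ∀ w ∈ S, ¬ H.Adj u w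
  · exact arrangeable_of_forall hE
  push Not at hE
  obtain ⟨u, hu, w, hw, huw⟩ := hE
  have hu0 := (degreeIn_pos hw huw).ne'
  have hw0 := (degreeIn_pos hu huw.symm).ne'
  refine Arrangeable.of_erase_padded hu hi hj (hne hu0 hi0) (hne hu0 hj0) hij hi0 hj0 ?_
  have hsub : ((S.erase u).erase i).erase j ⊆ S :=
    ((Finset.erase_subset _ _).trans (Finset.erase_subset _ _)).trans (Finset.erase_subset _ _)
  refine Arrangeable.of_erase_padded (w := w) (i := k) (j := m) ?_ ?_ ?_ (hne hw0 hk0)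
    (hne hw0 hm0) hkm (Nat.le_zero.1 (hk0 ▸ degreeIn_mono H hsub k))
    (Nat.le_zero.1 (hm0 ▸ degreeIn_mono H hsub m)) ?_
  · simp [hw, huw.ne', hne hw0 hi0, hne hw0 hj0]
  · simp [hk, (hne hu0 hk0).symm, hik.symm, hjk.symm]
  · simp [hm, (hne hu0 hm0).symm, him.symm, hjm.symm]
  refine arrangeable_of_forall fun a ha b hb hadj => ?_
  simp only [Finset.mem_erase] at ha hb
  obtain ⟨-, -, haw, -, -, hau, haS⟩ := ha
  obtain ⟨-, -, hbw, -, -, hbu, hbS⟩ := hb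
  have h4 : ({u, w, a, b} : Finset V).card = 4 :=
    Finset.card_eq_four.2
      ⟨u, w, a, b, huw.ne, hau.symm, hbu.symm, haw.symm, hbw.symm, hadj.ne, rfl⟩
  have h5 : ({u, w, a, b} : Finset V) ⊆ C := by
    simp only [Finset.insert_subset_iff, Finset.singleton_subset_iff]
    exact ⟨hmemC hu hw huw, hmemC hw hu huw.symm, hmemC haS hbS hadj, hmemC hbS haS hadj.symm⟩
  have := Finset.card_le_card h5
  omega

/-- A graph on `m` vertices with at most `m - 4` edges has a spread list of its vertices.
The induction removes a leaf if there is one. Otherwise every nonisolated vertex has degree at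
least two, so at least four vertices are isolated, and two of them serve to split off a vertex of
degree at least three or two nonadjacent vertices of degree two. Each time, at least as many edges
as vertices disappear. What remains is at most a triangle with isolated vertices. -/
theorem arrangeable_of_degreeSumIn_add_eight_le [DecidableEq V] (H : SimpleGraph V)
    (S : Finset V) (hS : H.degreeSumIn S + 8 ≤ 2 * S.card) : Arrangeable H S := by
  classical
  induction S using Finset.strongInduction with
  | H S ih =>
  by_cases hE : H.degreeSumIn S < 2
  · exact arrangeable_of_forall fun u hu v hv => not_adj_of_degreeSumIn_lt_two hE hu hv
  by_cases hleaf : ∃ v ∈ S, H.degreeIn S v = 1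
  · obtain ⟨v, hv, hv1⟩ := hleaf
    have h1 := degreeSumIn_erase H hv
    have h2 := Finset.card_erase_add_one hv
    obtain ⟨p, hp⟩ := Finset.card_eq_one.1 hv1
    rw [← Finset.insert_erase hv]
    refine (ih _ (Finset.erase_ssubset hv) (by omega)).insert_leaf (p := p) (by omega)
      (Finset.notMem_erase v S) fun u hu hadj => ?_
    have : u ∈ S.filter (H.Adj v) := Finset.mem_filter.2 ⟨Finset.mem_of_mem_erase hu, hadj⟩
    rwa [hp, Finset.mem_singleton] at this
  push Not at hleaf
  set I := S.filter (fun v => H.degreeIn S v = 0) with hI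
  set C := S.filter (fun v => ¬ H.degreeIn S v = 0) with hC
  have hIC : I.card + C.card = S.card := Finset.card_filter_add_card_filter_not _
  have hC2 : 2 * C.card ≤ H.degreeSumIn S := by
    calc 2 * C.card = C.card • 2 := by rw [smul_eq_mul, mul_comm]
      _ ≤ ∑ v ∈ C, H.degreeIn S v := by
          refine Finset.card_nsmul_le_sum _ _ _ fun v hv => ?_
          have := Finset.mem_filter.1 hv
          have := hleaf v this.1
          omega
      _ ≤ H.degreeSumIn S := Finset.sum_le_sum_of_subset (Finset.filter_subset _ _)
  obtain ⟨J, hJI, hJ⟩ := Finset.exists_subset_card_eq (show 4 ≤ I.card by omega)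
  obtain ⟨i, j, k, m, hij, hik, him, hjk, hjm, hkm, rfl⟩ := Finset.card_eq_four.1 hJ
  have hiso : ∀ v ∈ ({i, j, k, m} : Finset V), v ∈ S ∧ H.degreeIn S v = 0 := fun v hv =>
    Finset.mem_filter.1 (hJI hv)
  obtain ⟨hiS, hi0⟩ := hiso i (by simp)
  obtain ⟨hjS, hj0⟩ := hiso j (by simp)
  obtain ⟨hkS, hk0⟩ := hiso k (by simp)
  obtain ⟨hmS, hm0⟩ := hiso m (by simp)
  have hne : ∀ {a b : V}, H.degreeIn S a ≠ 0 → H.degreeIn S b = 0 → a ≠ b := by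
    rintro a b ha hb rfl
    exact ha hb
  by_cases h3 : ∃ w ∈ S, 3 ≤ H.degreeIn S w
  · obtain ⟨w, hw, hw3⟩ := h3
    have hwi : w ≠ i := hne (by omega) hi0
    have hwj : w ≠ j := hne (by omega) hj0
    have hi1 : i ∈ S.erase w := Finset.mem_erase.2 ⟨hwi.symm, hiS⟩
    have hj1 : j ∈ (S.erase w).erase i :=
      Finset.mem_erase.2 ⟨hij.symm, Finset.mem_erase.2 ⟨hwj.symm, hjS⟩⟩
    refine Arrangeable.of_erase_padded hw hiS hjS hwi hwj hij hi0 hj0 (ih _ ?_ ?_)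
    · exact ((Finset.erase_subset _ _).trans (Finset.erase_subset _ _)).trans_ssubset
        (Finset.erase_ssubset hw)
    · have e1 := degreeSumIn_erase H hw
      have e2 := degreeSumIn_erase H hi1
      have e3 := degreeSumIn_erase H hj1
      have c1 := Finset.card_erase_add_one hw
      have c2 := Finset.card_erase_add_one hi1
      have c3 := Finset.card_erase_add_one hj1
      omega
  push Not at h3
  by_cases hpair : ∃ u ∈ C, ∃ w ∈ C, u ≠ w ∧ ¬ H.Adj u w
  · obtain ⟨u, hu, w, hw, huw, hadj⟩ := hpair
    obtain ⟨hu, hu0⟩ := Finset.mem_filter.1 hu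
    obtain ⟨hw, hw0⟩ := Finset.mem_filter.1 hw
    have hui := hne hu0 hi0
    have huj := hne hu0 hj0
    have hwi := hne hw0 hi0
    have hwj := hne hw0 hj0
    have hw1 : w ∈ S.erase u := Finset.mem_erase.2 ⟨huw.symm, hw⟩
    have hi1 : i ∈ (S.erase u).erase w :=
      Finset.mem_erase.2 ⟨hwi.symm, Finset.mem_erase.2 ⟨hui.symm, hiS⟩⟩
    have hj1 : j ∈ ((S.erase u).erase w).erase i :=
      Finset.mem_erase.2 ⟨hij.symm, Finset.mem_erase.2 ⟨hwj.symm,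
        Finset.mem_erase.2 ⟨huj.symm, hjS⟩⟩⟩
    refine Arrangeable.of_erase_pair_padded hu hw hiS hjS huw hui huj hwi hwj hij hadj hi0 hj0
      (ih _ ?_ ?_)
    · exact (((Finset.erase_subset _ _).trans (Finset.erase_subset _ _)).trans
        (Finset.erase_subset _ _)).trans_ssubset (Finset.erase_ssubset hu)
    · have hw2 : H.degreeIn (S.erase u) w = H.degreeIn S w := by
        unfold degreeIn
        rw [Finset.filter_erase, Finset.erase_eq_of_notMem]
        exact fun h => hadj (Finset.mem_filter.1 h).2.symm
      have e1 := degreeSumIn_erase H hu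
      have e2 := degreeSumIn_erase H hw1
      have e3 := degreeSumIn_erase H hi1
      have e4 := degreeSumIn_erase H hj1
      have c1 := Finset.card_erase_add_one hu
      have c2 := Finset.card_erase_add_one hw1
      have c3 := Finset.card_erase_add_one hi1
      have c4 := Finset.card_erase_add_one hj1
      have d1 := hleaf u hu
      have d2 := hleaf w hw
      omega
  push Not at hpair
  -- Now the nonisolated vertices are pairwise adjacent and have degree two.
  have hC3 : C.card ≤ 3 := by
    by_contra! h
    obtain ⟨u, hu⟩ := Finset.card_pos.1 (by omega : 0 < C.card)
    have h1 : C.erase u ⊆ S.filter (H.Adj u) := fun v hv => by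
      rw [Finset.mem_erase] at hv
      exact Finset.mem_filter.2 ⟨(Finset.mem_filter.1 hv.2).1, hpair u hu v hv.2 hv.1.symm⟩
    have h2 := Finset.card_le_card h1
    have h4 := h3 u (Finset.mem_filter.1 hu).1
    rw [Finset.card_erase_of_mem hu] at h2
    unfold degreeIn at h4
    omega
  exact arrangeable_of_card_support_le_three hiS hjS hkS hmS hij hik him hjk hjm hkm hi0 hj0 hk0 hm0
    hC3

/-! ### At most one edge outside a star -/

/-- If all edges of `H` within `S` meet `c`, the list may start with `c` and two vertices not
adjacent to `c`. -/
theorem arrangeable_of_two_nonneighbors [DecidableEq V] {H : SimpleGraph V} {S : Finset V}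
    {c a b : V} (hc : c ∈ S) (ha : a ∈ S.erase c) (hb : b ∈ S.erase c) (hab : a ≠ b)
    (hca : ¬ H.Adj c a) (hcb : ¬ H.Adj c b)
    (hT : ∀ u ∈ S.erase c, ∀ v ∈ S.erase c, ¬ H.Adj u v) : Arrangeable H S := by
  rw [Finset.mem_erase] at ha hb
  refine ⟨c :: a :: b :: (((S.erase c).erase a).erase b).toList, ?_, fun v => ?_, ?_⟩
  · simp [Finset.nodup_toList, ha.1.symm, hb.1.symm, hab]
  · simp only [List.mem_cons, Finset.mem_toList, Finset.mem_erase]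
    by_cases h0 : v = c
    · simp [h0, hc]
    by_cases h1 : v = a
    · simp [h1, ha.2]
    by_cases h2 : v = b
    · simp [h2, hb.2]
    simp [h0, h1, h2]
  · refine Spread.cons_cons_cons hca hcb (spread_of_forall fun u hu v hv => hT u ?_ v ?_)
    all_goals
      simp only [List.mem_cons, Finset.mem_toList, Finset.mem_erase] at *
    · rcases hu with rfl | rfl | hu
      exacts [ha, hb, hu.2.2]
    · rcases hv with rfl | rfl | hv
      exacts [ha, hb, hv.2.2]

open Classical in
/-- If `x y` is the only edge of `H` within `S` that avoids `c`, and `x` is not adjacent to `c`,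
then the list `c, x, b, i, …` is spread for suitable `b` not adjacent to `c` and any `i ≠ y`. -/
theorem arrangeable_of_single_edge_at_nonneighbor {H : SimpleGraph V}
    {S : Finset V} {c x y : V} (hS : 5 ≤ S.card) (hc : c ∈ S) (hx : x ∈ S)
    (hcx : c ≠ x) (hxy : x ≠ y)
    (hA : 3 ≤ ((S.erase c).filter (fun v => ¬ H.Adj c v)).card) (hxA : ¬ H.Adj c x)
    (hT : ∀ u ∈ S.erase c, ∀ v ∈ S.erase c, H.Adj u v → u = x ∧ v = y ∨ u = y ∧ v = x) :
    Arrangeable H S := by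
  obtain ⟨b, hb, hbxy⟩ := Finset.exists_mem_notMem_of_card_lt_card
    (s := {x, y}) (lt_of_le_of_lt Finset.card_le_two (by omega : 2 < _) :
      _ < ((S.erase c).filter (fun v => ¬ H.Adj c v)).card)
  obtain ⟨i, hi, hicxby⟩ := Finset.exists_mem_notMem_of_card_lt_card
    (s := {c, x, b, y}) (lt_of_le_of_lt Finset.card_le_four (by omega : 4 < S.card))
  simp only [Finset.mem_filter, Finset.mem_erase] at hb
  obtain ⟨⟨hbc, hbS⟩, hcb⟩ := hb
  simp only [Finset.mem_insert, Finset.mem_singleton, not_or] at hbxy hicxby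
  obtain ⟨hbx, hby⟩ := hbxy
  obtain ⟨hic, hix, hib, hiy⟩ := hicxby
  refine ⟨c :: x :: b :: i :: ((((S.erase c).erase x).erase b).erase i).toList, ?_,
    fun v => ?_, ?_⟩
  · simp [Finset.nodup_toList, hcx, Ne.symm hbc, Ne.symm hic, Ne.symm hbx, Ne.symm hix,
      Ne.symm hib]
  · simp only [List.mem_cons, Finset.mem_toList, Finset.mem_erase]
    by_cases h0 : v = c
    · simp [h0, hc]
    by_cases h1 : v = x
    · simp [h1, hx]
    by_cases h2 : v = b
    · simp [h2, hbS]
    by_cases h3 : v = i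
    · simp [h3, hi]
    simp [h0, h1, h2, h3]
  · have hmem : ∀ u, u ∈ b :: i :: ((((S.erase c).erase x).erase b).erase i).toList →
        u ∈ S.erase c ∧ u ≠ x := by
      intro u hu
      simp only [List.mem_cons, Finset.mem_toList, Finset.mem_erase] at hu ⊢
      rcases hu with rfl | rfl | hu
      exacts [⟨⟨hbc, hbS⟩, hbx⟩, ⟨⟨hic, hi⟩, hix⟩, ⟨hu.2.2.2, hu.2.2.1⟩]
    have hxT : x ∈ S.erase c := Finset.mem_erase.2 ⟨hcx.symm, hx⟩
    refine Spread.cons_cons_cons hxA hcb (Spread.cons_cons_cons ?_ ?_ (spread_of_forall ?_))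
    · intro h
      rcases hT x hxT b (hmem b (by simp)).1 h with h' | h'
      exacts [hby h'.2, hxy h'.1]
    · intro h
      rcases hT x hxT i (hmem i (by simp)).1 h with h' | h'
      exacts [hiy h'.2, hxy h'.1]
    · intro u hu v hv h
      rcases hT u (hmem u hu).1 v (hmem v hv).1 h with h' | h'
      exacts [(hmem u hu).2 h'.1, (hmem v hv).2 h'.2]

open Classical in
/-- If `x y` is the only edge of `H` within `S` that avoids `c`, and `x`, `y` are adjacent to `c`,
then the list `c, a, b, x, i, j, …` is spread, where `a`, `b` are not adjacent to `c` and `y` comes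
after `j`. This needs seven vertices: with six, the triangle `c x y` is an obstruction. -/
theorem arrangeable_of_single_edge_between_neighbors {H : SimpleGraph V}
    {S : Finset V} {c x y : V} (hS : 7 ≤ S.card) (hc : c ∈ S) (hx : x ∈ S)
    (hxy : x ≠ y)
    (hA : 2 ≤ ((S.erase c).filter (fun v => ¬ H.Adj c v)).card)
    (hcx : H.Adj c x) (hcy : H.Adj c y)
    (hT : ∀ u ∈ S.erase c, ∀ v ∈ S.erase c, H.Adj u v → u = x ∧ v = y ∨ u = y ∧ v = x) :
    Arrangeable H S := by
  obtain ⟨a, ha, b, hb, hab⟩ := Finset.one_lt_card.1 hA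
  simp only [Finset.mem_filter, Finset.mem_erase] at ha hb
  obtain ⟨⟨hac, haS⟩, hca⟩ := ha
  obtain ⟨⟨hbc, hbS⟩, hcb⟩ := hb
  have hax : a ≠ x := fun h => hca (h ▸ hcx)
  have hay : a ≠ y := fun h => hca (h ▸ hcy)
  have hbx : b ≠ x := fun h => hcb (h ▸ hcx)
  have hby : b ≠ y := fun h => hcb (h ▸ hcy)
  obtain ⟨i, hi, j, hj, hij⟩ : ∃ i ∈ S \ {c, a, b, x, y}, ∃ j ∈ S \ {c, a, b, x, y}, i ≠ j := by
    refine Finset.one_lt_card.1 ?_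
    have h1 := Finset.le_card_sdiff {c, a, b, x, y} S
    have h2 : ({c, a, b, x, y} : Finset V).card ≤ 5 := Finset.card_le_five
    omega
  simp only [Finset.mem_sdiff, Finset.mem_insert, Finset.mem_singleton, not_or] at hi hj
  obtain ⟨hi, hic, hia, hib, hix, hiy⟩ := hi
  obtain ⟨hj, hjc, hja, hjb, hjx, hjy⟩ := hj
  set R := ((((((S.erase c).erase a).erase b).erase x).erase i).erase j).toList with hR
  have hmem : ∀ u, u ∈ i :: j :: R → u ∈ S.erase c ∧ u ≠ x := by
    intro u hu
    simp only [hR, List.mem_cons, Finset.mem_toList, Finset.mem_erase] at hu ⊢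
    rcases hu with rfl | rfl | hu
    exacts [⟨⟨hic, hi⟩, hix⟩, ⟨⟨hjc, hj⟩, hjx⟩, ⟨hu.2.2.2.2.2, hu.2.2.1⟩]
  have hxT : x ∈ S.erase c := Finset.mem_erase.2 ⟨hcx.ne', hx⟩
  -- a vertex other than `x` and `y` has no neighbour other than `c`
  have hfree : ∀ w ∈ S.erase c, w ≠ x → w ≠ y → ∀ u ∈ S.erase c, ¬ H.Adj w u := by
    intro w hw hwx hwy u hu h
    rcases hT w hw u hu h with h' | h'
    exacts [hwx h'.1, hwy h'.1]
  have haT : a ∈ S.erase c := Finset.mem_erase.2 ⟨hac, haS⟩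
  have hbT : b ∈ S.erase c := Finset.mem_erase.2 ⟨hbc, hbS⟩
  have hxl : ∀ u ∈ x :: i :: j :: R, u ∈ S.erase c := by
    intro u hu
    rcases List.mem_cons.1 hu with rfl | hu
    exacts [hxT, (hmem u hu).1]
  refine ⟨c :: a :: b :: x :: i :: j :: R, ?_, fun v => ?_, ?_⟩
  · simp [hR, Finset.nodup_toList, Ne.symm hac, Ne.symm hbc, hcx.ne, Ne.symm hic, Ne.symm hjc,
      hab, hax, Ne.symm hia, Ne.symm hja, hbx, Ne.symm hib, Ne.symm hjb, Ne.symm hix,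
      Ne.symm hjx, hij]
  · simp only [hR, List.mem_cons, Finset.mem_toList, Finset.mem_erase]
    by_cases h0 : v = c
    · simp [h0, hc]
    by_cases h1 : v = a
    · simp [h1, haS]
    by_cases h2 : v = b
    · simp [h2, hbS]
    by_cases h3 : v = x
    · simp [h3, hx]
    by_cases h4 : v = i
    · simp [h4, hi]
    by_cases h5 : v = j
    · simp [h5, hj]
    simp [h0, h1, h2, h3, h4, h5]
  · refine Spread.cons_cons_cons hca hcb (Spread.cons_of_forall (fun u hu => ?_)
      (Spread.cons_of_forall (fun u hu => ?_) (Spread.cons_cons_cons ?_ ?_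
        (spread_of_forall ?_))))
    · refine hfree a haT hax hay u ?_
      rcases List.mem_cons.1 hu with rfl | hu
      exacts [hbT, hxl u hu]
    · exact hfree b hbT hbx hby u (hxl u hu)
    · exact fun h => hfree i (hmem i (by simp)).1 hix hiy x hxT h.symm
    · exact fun h => hfree j (hmem j (by simp)).1 hjx hjy x hxT h.symm
    · intro u hu v hv h
      rcases hT u (hmem u hu).1 v (hmem v hv).1 h with h' | h'
      exacts [(hmem u hu).2 h'.1, (hmem v hv).2 h'.2]

/-! ### From lists and numberings to copies of graphs -/

theorem val_le_add_length_of_walk_pathGraph {n : ℕ} {i j : Fin n} (p : (pathGraph n).Walk i j) :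
    (j : ℕ) ≤ i + p.length := by
  induction p with
  | nil => simp
  | cons h p ih =>
    rw [pathGraph_adj] at h
    rw [Walk.length_cons]
    omega

theorem val_le_add_two_of_square_pathGraph_adj {n : ℕ} {i j : Fin n}
    (h : (pathGraph n).square.Adj i j) : (j : ℕ) ≤ i + 2 := by
  obtain ⟨p, hp⟩ := exists_walk_of_edist_ne_top (ne_top_of_le_ne_top (by simp) h.2)
  have h2 : (p.length : ℕ∞) ≤ 2 := hp ▸ h.2
  have h3 : p.length ≤ 2 := by exact_mod_cast h2
  have := val_le_add_length_of_walk_pathGraph p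
  omega

theorem Arrangeable.square_pathGraph_isContained [Fintype V] {G : SimpleGraph V}
    (h : Arrangeable Gᶜ Finset.univ) : (pathGraph (Fintype.card V)).square ⊑ G := by
  classical
  obtain ⟨l, hl, hmem, hs⟩ := h
  have hlen : Fintype.card V = l.length := by
    rw [← List.toFinset_card_of_nodup hl, show l.toFinset = Finset.univ from
      Finset.ext fun u => by rw [List.mem_toFinset, hmem], Finset.card_univ]
  rw [spread_iff_getElem] at hs
  have key : ∀ i j : Fin (Fintype.card V), (i : ℕ) < j →
      (pathGraph (Fintype.card V)).square.Adj i j →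
      G.Adj (l[(i : ℕ)]'(hlen ▸ i.2)) (l[(j : ℕ)]'(hlen ▸ j.2)) := by
    intro i j hij hadj
    have h1 := hs i j hij (hlen ▸ j.2) (val_le_add_two_of_square_pathGraph_adj hadj)
    rw [compl_adj] at h1
    by_contra hG
    exact h1 ⟨fun he => hij.ne ((hl.getElem_inj_iff).1 he), hG⟩
  refine ⟨⟨⟨fun i => l[(i : ℕ)]'(hlen ▸ i.2), fun {i j} hadj => ?_⟩, fun i j hij => ?_⟩⟩
  · rcases lt_or_gt_of_ne (fun he => hadj.ne (Fin.ext he) : (i : ℕ) ≠ j) with hij | hij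
    · exact key i j hij hadj
    · exact (key j i hij hadj.symm).symm
  · exact Fin.ext ((hl.getElem_inj_iff).1 hij)

/-- `G` lies in `K_n - E(K)` as soon as some numbering of its vertices makes the copy of `K` on the
first `m` vertices avoid all edges of `G`. -/
theorem isContained_completeMinus {G : SimpleGraph V} {n m : ℕ} (h : m ≤ n)
    (K : SimpleGraph (Fin m)) (e : V ≃ Fin n)
    (he : ∀ i j, K.Adj i j → ¬ G.Adj (e.symm (Fin.castLE h i)) (e.symm (Fin.castLE h j))) :
    G ⊑ completeMinus n h K := by
  refine ⟨⟨⟨e, fun {u v} hadj => ?_⟩, e.injective⟩⟩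
  rw [completeMinus, deleteEdges_adj, top_adj, mem_edgeSet]
  refine ⟨e.injective.ne hadj.ne, ?_⟩
  rintro ⟨-, i, j, hij, hi, hj⟩
  refine he i j hij ?_
  change Fin.castLE h i = e u at hi
  change Fin.castLE h j = e v at hj
  rwa [hi, hj, e.symm_apply_apply, e.symm_apply_apply]

/-- A partial injective numbering of the vertices extends to a full numbering. -/
theorem exists_equiv_fin_eqOn [Fintype V] [DecidableEq V] {n : ℕ} (hV : Fintype.card V = n)
    (s : Finset V) (f : V → Fin n) (hf : Set.InjOn f s) : ∃ e : V ≃ Fin n, ∀ v ∈ s, e v = f v := by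
  obtain ⟨g, hg⟩ := Finset.exists_equiv_extend_of_card_eq (t := (Finset.univ : Finset (Fin n)))
    (by simpa using hV) (Finset.subset_univ _) hf
  exact ⟨g.trans (Equiv.subtypeUnivEquiv Finset.mem_univ), hg⟩

theorem isContained_completeMinus_starGraph [Fintype V] [DecidableEq V] {G : SimpleGraph V}
    {n : ℕ} (hn : 2 ≤ n) (hV : Fintype.card V = n) {c a : V} (hca : c ≠ a)
    (h : ∀ v, v ≠ c → v ≠ a → ¬ G.Adj c v) :
    G ⊑ completeMinus n (Nat.sub_le n 1) (starGraph (⟨0, by omega⟩ : Fin (n - 1))) := by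
  obtain ⟨e, he⟩ := exists_equiv_fin_eqOn hV {c, a}
    (fun v => if v = c then ⟨0, by omega⟩ else ⟨n - 1, by omega⟩) (by
      intro u hu v hv huv
      have h1 : ¬ (0 = n - 1) := by omega
      have h2 : ¬ (n - 1 = 0) := by omega
      simp only [Finset.coe_insert, Finset.coe_singleton, Set.mem_insert_iff,
        Set.mem_singleton_iff] at hu hv
      rcases hu with rfl | rfl <;> rcases hv with rfl | rfl <;>
        simp [hca.symm, h1, h2] at huv ⊢)
  have hec : e c = ⟨0, by omega⟩ := by simpa using he c (by simp)
  have hea : e a = ⟨n - 1, by omega⟩ := by simpa [hca.symm] using he a (by simp)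
  have key : ∀ j : Fin (n - 1), (⟨0, by omega⟩ : Fin (n - 1)) ≠ j →
      ¬ G.Adj c (e.symm (Fin.castLE (Nat.sub_le n 1) j)) := by
    intro j hj
    refine h _ (fun h' => hj ?_) (fun h' => ?_)
    · rw [Equiv.symm_apply_eq, hec] at h'
      exact Fin.ext (Fin.ext_iff.1 h').symm
    · rw [Equiv.symm_apply_eq, hea] at h'
      have h1 := Fin.ext_iff.1 h'
      have h2 := j.2
      simp only [Fin.val_castLE] at h1
      omega
  have hec' : e.symm (Fin.castLE (Nat.sub_le n 1) ⟨0, by omega⟩) = c := by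
    rw [Equiv.symm_apply_eq, hec]; rfl
  refine isContained_completeMinus _ _ e fun i j hij => ?_
  rw [starGraph_adj] at hij
  obtain ⟨hij, rfl | rfl⟩ := hij
  · rw [hec']
    exact key j hij
  · rw [hec', adj_comm]
    exact key i hij.symm

theorem isContained_completeMinus_top_three [Fintype V] [DecidableEq V] {G : SimpleGraph V}
    {n : ℕ} (hn : 3 ≤ n) (hV : Fintype.card V = n) {x y z : V} (hxy : Gᶜ.Adj x y)
    (hxz : Gᶜ.Adj x z) (hyz : Gᶜ.Adj y z) :
    G ⊑ completeMinus n hn (⊤ : SimpleGraph (Fin 3)) := by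
  obtain ⟨e, he⟩ := exists_equiv_fin_eqOn hV {x, y, z}
    (fun v => if v = x then ⟨0, by omega⟩ else if v = y then ⟨1, by omega⟩ else ⟨2, by omega⟩) (by
      intro u hu v hv huv
      simp only [Finset.coe_insert, Finset.coe_singleton, Set.mem_insert_iff,
        Set.mem_singleton_iff] at hu hv
      rcases hu with rfl | rfl | rfl <;> rcases hv with rfl | rfl | rfl <;>
        simp [hxy.ne', hxz.ne', hyz.ne'] at huv ⊢)
  have hex : e.symm (Fin.castLE hn 0) = x := by
    rw [Equiv.symm_apply_eq, he x (by simp)]; simp; rfl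
  have hey : e.symm (Fin.castLE hn 1) = y := by
    rw [Equiv.symm_apply_eq, he y (by simp)]; simp [hxy.ne']; rfl
  have hez : e.symm (Fin.castLE hn 2) = z := by
    rw [Equiv.symm_apply_eq, he z (by simp)]; simp [hxz.ne', hyz.ne']; rfl
  refine isContained_completeMinus _ _ e fun i j hij => ?_
  have h01 := hxy.2
  have h02 := hxz.2
  have h12 := hyz.2
  rw [top_adj] at hij
  fin_cases i <;> fin_cases j <;>
    first
    | exact absurd rfl hij
    | simpa [hex, hey, hez] using h01
    | simpa [hex, hey, hez] using h02
    | simpa [hex, hey, hez] using h12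
    | simpa [hex, hey, hez, adj_comm] using h01
    | simpa [hex, hey, hez, adj_comm] using h02
    | simpa [hex, hey, hez, adj_comm] using h12

/-! ### The trichotomy -/

theorem degreeIn_univ [Fintype V] [DecidableEq V] (G : SimpleGraph V) [DecidableRel G.Adj]
    (v : V) : G.degreeIn Finset.univ v = G.degree v := by
  unfold degreeIn
  rw [← card_neighborFinset_eq_degree]
  congr 1
  ext u
  simp

open Classical in
/-- The combinatorial core. If the complement `H` has `e` edges, `f` of which avoid `c`, the
hypothesis reads `e + f ≤ n - 2`. For `f ≥ 2` this gives `e ≤ n - 4`, and the cases `f = 1` and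
`f = 0` are explicit. -/
theorem square_pathGraph_isContained_or_of_compl_degreeSumIn_le [Fintype V]
    {G H : SimpleGraph V} (hGH : Gᶜ = H) {n : ℕ} (hn : 6 ≤ n) (hV : Fintype.card V = n) (c : V)
    (hsum : H.degreeSumIn Finset.univ + 2 ≤ n + H.degreeIn Finset.univ c) :
    (pathGraph n).square ⊑ G ∨
      G ⊑ completeMinus n (Nat.sub_le n 1) (starGraph (⟨0, by omega⟩ : Fin (n - 1))) ∨
      (n = 6 ∧ G ⊑ completeMinus n (show 3 ≤ n by omega) (⊤ : SimpleGraph (Fin 3))) := by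
  subst hV
  have hpath : Arrangeable H Finset.univ → (pathGraph (Fintype.card V)).square ⊑ G := fun h =>
    (hGH ▸ h : Arrangeable Gᶜ Finset.univ).square_pathGraph_isContained
  set T : Finset V := Finset.univ.erase c with hTdef
  have hET : H.degreeSumIn T + 2 * H.degreeIn Finset.univ c = H.degreeSumIn Finset.univ := by
    exact degreeSumIn_erase H (Finset.mem_univ c)
  have hA : (T.filter (fun v => ¬ H.Adj c v)).card + H.degreeIn Finset.univ c + 1
      = Fintype.card V := by
    rw [← degreeIn_erase_self, degreeIn, add_comm _ (Finset.card _),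
      Finset.card_filter_add_card_filter_not, Finset.card_erase_add_one (Finset.mem_univ c),
      Finset.card_univ]
  by_cases h4 : 4 ≤ H.degreeSumIn T
  · exact Or.inl (hpath (arrangeable_of_degreeSumIn_add_eight_le H _ (by
      rw [Finset.card_univ]; omega)))
  -- `H` has at most one edge within `T`; the case of no edge comes before that of one.
  by_cases hT0 : ∀ u ∈ T, ∀ v ∈ T, ¬ H.Adj u v
  · by_cases hA2 : 2 ≤ (T.filter (fun v => ¬ H.Adj c v)).card
    · obtain ⟨a, ha, b, hb, hab⟩ := Finset.one_lt_card.1 hA2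
      rw [Finset.mem_filter] at ha hb
      exact Or.inl (hpath (arrangeable_of_two_nonneighbors (Finset.mem_univ c) ha.1 hb.1 hab
        ha.2 hb.2 hT0))
    · obtain ⟨a, ha⟩ := Finset.card_eq_one.1
        (by omega : (T.filter (fun v => ¬ H.Adj c v)).card = 1)
      have haT : a ∈ T.filter (fun v => ¬ H.Adj c v) := ha ▸ Finset.mem_singleton_self a
      refine Or.inr (Or.inl (isContained_completeMinus_starGraph (by omega) rfl
        (Finset.ne_of_mem_erase (Finset.mem_filter.1 haT).1).symm fun v hvc hva hadj => hva ?_))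
      rw [← Finset.mem_singleton, ← ha, Finset.mem_filter]
      exact ⟨Finset.mem_erase.2 ⟨hvc, Finset.mem_univ v⟩, fun h => (hGH ▸ h : Gᶜ.Adj c v).2 hadj⟩
  push Not at hT0
  obtain ⟨x, hx, y, hy, hxy⟩ := hT0
  have hErase : ∀ {u v}, u ∈ T → v ∈ T → H.Adj u v →
      2 ≤ H.degreeSumIn T ∧ H.degreeIn T u = 1 ∧ H.degreeSumIn (T.erase u) < 2 := by
    intro u v hu hv huv
    have h1 := degreeSumIn_erase H hu
    have h2 := degreeIn_pos hv huv
    omega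
  obtain ⟨h2, hx1, hx2⟩ := hErase hx hy hxy
  obtain ⟨-, hy1, -⟩ := hErase hy hx hxy.symm
  have huniq : ∀ {u v w}, H.degreeIn T u = 1 → v ∈ T → w ∈ T → H.Adj u v → H.Adj u w → v = w :=
    fun h hv hw huv huw => Finset.card_le_one.1 h.le _ (Finset.mem_filter.2 ⟨hv, huv⟩) _
      (Finset.mem_filter.2 ⟨hw, huw⟩)
  have hT1 : ∀ u ∈ T, ∀ v ∈ T, H.Adj u v → u = x ∧ v = y ∨ u = y ∧ v = x := by
    intro u hu v hv huv
    by_cases hux : u = x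
    · subst hux
      exact Or.inl ⟨rfl, huniq hx1 hv hy huv hxy⟩
    by_cases hvx : v = x
    · subst hvx
      exact Or.inr ⟨huniq hx1 hu hy huv.symm hxy, rfl⟩
    exact absurd huv (not_adj_of_degreeSumIn_lt_two hx2 (Finset.mem_erase.2 ⟨hux, hu⟩)
      (Finset.mem_erase.2 ⟨hvx, hv⟩))
  have hcx : c ≠ x := (Finset.ne_of_mem_erase hx).symm
  have hcy : c ≠ y := (Finset.ne_of_mem_erase hy).symm
  have hA3 : 3 ≤ (T.filter (fun v => ¬ H.Adj c v)).card := by omega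
  by_cases hcxA : H.Adj c x
  · by_cases hcyA : H.Adj c y
    · by_cases hn7 : 7 ≤ Fintype.card V
      · exact Or.inl (hpath (arrangeable_of_single_edge_between_neighbors hn7 (Finset.mem_univ c)
          (Finset.mem_univ x) hxy.ne ((by norm_num : 2 ≤ 3).trans hA3) hcxA hcyA hT1))
      · exact Or.inr (Or.inr ⟨by omega,
          isContained_completeMinus_top_three (by omega) rfl (hGH ▸ hcxA) (hGH ▸ hcyA)
            (hGH ▸ hxy)⟩)
    · exact Or.inl (hpath (arrangeable_of_single_edge_at_nonneighbor
        (by rw [Finset.card_univ]; omega) (Finset.mem_univ c) (Finset.mem_univ y)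
        hcy hxy.ne' hA3 hcyA
        fun u hu v hv h => (hT1 u hu v hv h).symm))
  · exact Or.inl (hpath (arrangeable_of_single_edge_at_nonneighbor
      (by rw [Finset.card_univ]; omega) (Finset.mem_univ c) (Finset.mem_univ x)
      hcx hxy.ne hA3 hcxA hT1))

end SimpleGraph

open SimpleGraph in
theorem theorem1p5 {V : Type*} [Fintype V] [DecidableEq V]
    (G : SimpleGraph V) [DecidableRel G.Adj] (n : ℕ) (hn : 6 ≤ n)
    (hV : Fintype.card V = n) (hμ : (n : ℝ) - 2 < G.adjSpectralRadius) :
    (SimpleGraph.pathGraph n).square ⊑ G ∨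
      G ⊑ SimpleGraph.completeMinus n (Nat.sub_le n 1)
        (SimpleGraph.starGraph (⟨0, by omega⟩ : Fin (n - 1))) ∨
      (n = 6 ∧ G ⊑ SimpleGraph.completeMinus n (show 3 ≤ n by omega)
        (⊤ : SimpleGraph (Fin 3))) := by
  have hne : Nonempty V := Fintype.card_pos_iff.1 (by omega)
  obtain ⟨c, -, hc⟩ := Finset.exists_max_image Finset.univ (fun v => Gᶜ.degree v)
    Finset.univ_nonempty
  have hE : Gᶜ.degreeSumIn Finset.univ = ∑ v, Gᶜ.degree v :=
    Finset.sum_congr rfl fun v _ => degreeIn_univ Gᶜ v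
  refine square_pathGraph_isContained_or_of_compl_degreeSumIn_le rfl hn hV c ?_
  rw [hE, degreeIn_univ]
  by_contra! h
  rw [← hV] at hμ
  exact hμ.not_ge (adjSpectralRadius_le_card_sub_two G _ (fun v => hc v (Finset.mem_univ v))
    (by omega) (by omega))
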